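/- Let $K$ be an algebraically closed field (of any characteristic) and $R=K[x_0,x_1,x_2]$ the homogeneous coordinate ring of $\mathbb P^2$. A fat point scheme $A=\sum_p A_p\,p$ (finitely many points $p\in\mathbb P^2$, integers $A_p\ge 0$) is the subscheme with ideal $I_A=\bigcap_p I_p^{A_p}$, where $I_p$ is generated by the forms vanishing at $p$; its Hilbert function is $h_A(t)=\dim_K (R/I_A)_t$ for $t\ge 0$. For a line $L$ with equation $F=0$, the residual $A:L$ is the scheme with ideal $I_A:F$. A vector $(d_1,\dots,d_r)$ is a *full reduction vector* for $A$ if there are lines $\Lambda_1,\dots,\Lambda_r$, not necessarily distinct, such that, with $A_0=A$ and $A_j=A_{j-1}:\Lambda_j$, the scheme $A_r$ is empty and $d_j=\deg(\Lambda_j\cap A_{j-1})$ for all $j$ (scheme-theoretic intersection). For a vector $v=(v_1,\dots,v_r)$ of non-negative integers and $t\ge 0$ put $$f_v(t)=\sum_{i=0}^{r-1}\max\bigl(0,\min(t-i+1,v_{i+1})\bigr),\qquad F_v(t)=\min_{0\le i\le r}\Bigl(\tbinom{t+2}{2}-\tbinom{t-i+2}{2}+\sum_{j=i+1}^{r}v_j\Bigr),$$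 with $\binom n2=0$ for $n<2$. Let $\operatorname{diag}(v)=(c_0,c_1,\dots)$, where $c_t$ is the number of pairs $(i,j)$ of integers with $0\le j<r$, $0\le i<v_{j+1}$ and $i+j=t$, and let $\sum\operatorname{diag}(v)$ be the sequence of partial sums $t\mapsto c_0+\dots+c_t$. A non-increasing $v$ is *GMS* if $v_i-v_j\ge j-i-1$ for all $1\le i<j\le r$. **Theorem.** Let $a=(a_1,\dots,a_s)$ and $m=(m_1,\dots,m_s)$ be vectors of positive integers. Let $L_1,\dots,L_s\subset\mathbb P^2$ be distinct lines and let $Z_i\subset L_i$ be a set of exactly $m_i$ points, such that no point of $Z_1\cup\dots\cup Z_s$ lies on two of the lines $L_1,\dots,L_s$ (that is, $Z_1+\dots+Z_s$ is a line count configuration of type $m$). Let $Z(a,m)=a_1Z_1+\dots+a_sZ_s$ be the fat point scheme in which each point of $Z_i$ has multiplicity $a_i$. Let $a*m$ be the vector with $a_1+\dots+a_s$ entries obtained by arranging the numbers $a_im_i,(a_i-1)m_i,\dots,2m_i,m_i$ $(i=1,\dots,s)$ in non-increasing order. Then $a*m$ is a full reduction vector for $Z(a,m)$, and for all $t\ge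 0$ $$f_{a*m}(t)\le h_{Z(a,m)}(t)\le F_{a*m}(t).$$ If $a*m$ is GMS, then $h_{Z(a,m)}=f_{a*m}=F_{a*m}=\sum\operatorname{diag}(a*m)$. -/

import Mathlib

open scoped LinearAlgebra.Projectivization

noncomputable section

/-! ## Points and lines of the projective plane -/

/-- Points of the projective plane over `K`. -/
abbrev PlanePoint (K : Type*) [Field K] : Type _ := ℙ K (Fin 3 → K)

/-- Lines of the projective plane: the class of `(c₀, c₁, c₂)` stands for the line
`c₀ x₀ + c₁ x₁ + c₂ x₂ = 0`. -/
abbrev PlaneLine (K : Type*) [Field K] : Type _ := ℙ K (Fin 3 → K)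

/-- The homogeneous coordinate ring `K[x₀, x₁, x₂]`. -/
abbrev CoordRing (K : Type*) [Field K] : Type _ := MvPolynomial (Fin 3) K

/-- The point `p` lies on the line `L`, that is `c₀ p₀ + c₁ p₁ + c₂ p₂ = 0`. -/
def OnLine {K : Type*} [Field K] (p : PlanePoint K) (L : PlaneLine K) : Prop :=
  Projectivization.orthogonal L p

/-- A linear form defining `L` (it is determined up to a nonzero scalar, and the scalar does
not matter for the ideals below). -/
def lineForm {K : Type*} [Field K] (L : PlaneLine K) : CoordRing K :=
  ∑ i : Fin 3, MvPolynomial.C (L.rep i) * MvPolynomial.X i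

/-! ## Fat point schemes, Hilbert functions, degrees -/

/-- The ideal generated by all forms vanishing at `p`. -/
def pointIdeal {K : Type*} [Field K] (p : PlanePoint K) : Ideal (CoordRing K) :=
  Ideal.span {G | (∃ e : ℕ, G.IsHomogeneous e) ∧ MvPolynomial.eval p.rep G = 0}

/-- A fat point scheme `m₁ p₁ + ⋯ + m_r p_r`, recorded by its multiplicities. -/
abbrev FatPoints (K : Type*) [Field K] : Type _ := PlanePoint K →₀ ℕ

/-- The ideal `I_A = ⋂ I_p ^ A(p)` of the fat point scheme `A`. (Points of multiplicity `0`
contribute the unit ideal.) -/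
def FatPoints.ideal {K : Type*} [Field K] (A : FatPoints K) : Ideal (CoordRing K) :=
  ⨅ p : PlanePoint K, pointIdeal p ^ A p

/-- The reduced scheme `p₁ + ⋯ + p_r` on a finite set of points. -/
def reducedScheme {K : Type*} [Field K] (S : Finset (PlanePoint K)) : FatPoints K :=
  ∑ p ∈ S, Finsupp.single p 1

/-- The Hilbert function `t ↦ dim_K (R / I)_t = dim_K (R_t / I_t)` of a homogeneous ideal
`I` of `R = K[x₀, x₁, x₂]`. -/
def hilbertFun {K : Type*} [Field K] (I : Ideal (CoordRing K)) (t : ℕ) : ℕ :=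
  Module.finrank K
    (↥(MvPolynomial.homogeneousSubmodule (Fin 3) K t) ⧸
      (I.restrictScalars K).comap (MvPolynomial.homogeneousSubmodule (Fin 3) K t).subtype)

/-- The subscheme of the plane defined by the homogeneous ideal `I` is finite of degree `d`:
its Hilbert polynomial is the constant `d`. -/
def HasFiniteDegree {K : Type*} [Field K] (I : Ideal (CoordRing K)) (d : ℕ) : Prop :=
  ∃ t₀ : ℕ, ∀ t : ℕ, t₀ ≤ t → hilbertFun I t = d

/-! ## Residuals and reduction vectors -/

/-- The ideal `I : F` of the residual with respect to the line `L`, where `F` is a form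
defining `L`. -/
def residualIdeal {K : Type*} [Field K] (I : Ideal (CoordRing K)) (L : PlaneLine K) :
    Ideal (CoordRing K) :=
  Submodule.colon I {lineForm L}

/-- The ideal `I + (F)` of the scheme-theoretic intersection with the line `L`, where `F` is a
form defining `L`. -/
def intersectionIdeal {K : Type*} [Field K] (I : Ideal (CoordRing K)) (L : PlaneLine K) :
    Ideal (CoordRing K) :=
  I ⊔ Ideal.span {lineForm L}

/-- `TotallyReducesWith I Ls d`: for the scheme `A₀` with ideal `I`, the lines
`Ls = (L₁, …, L_r)` and the residuals `A_j = A_{j-1} : L_j`, one has `d = (d₁, …, d_r)` with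
`d_j = deg (L_j ∩ A_{j-1})`, and `A_r` is empty (its ideal is the unit ideal). -/
def TotallyReducesWith {K : Type*} [Field K] :
    Ideal (CoordRing K) → List (PlaneLine K) → List ℕ → Prop
  | I, [], [] => I = ⊤
  | I, L :: Ls, d :: ds =>
      HasFiniteDegree (intersectionIdeal I L) d ∧ TotallyReducesWith (residualIdeal I L) Ls ds
  | _, [], _ :: _ => False
  | _, _ :: _, [] => False

/-- `d` is a full reduction vector for `A`: it is the reduction vector of `A` with respect to
some sequence of (not necessarily distinct) lines that totally reduces `A`. -/
def IsFullReductionVector {K : Type*} [Field K] (A : FatPoints K) (d : List ℕ) : Prop :=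
  ∃ Ls : List (PlaneLine K), TotallyReducesWith A.ideal Ls d

/-! ## The bounds `f_v`, `F_v`, and diagonal counts -/

/-- `f_v(t) = ∑_{0 ≤ i < r} max(0, min(t - i + 1, v_{i+1}))` for `v = (v₁, …, v_r)`.
(Truncated subtraction gives the positive part.) -/
def lowerBoundFun (v : List ℕ) (t : ℕ) : ℕ :=
  ∑ i : Fin v.length, min (t + 1 - (i : ℕ)) (v.get i)

/-- `F_v(t) = min_{0 ≤ i ≤ r} (binom(t+2, 2) - binom(t-i+2, 2) + ∑_{i < j ≤ r} v_j)`, where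
`binom(n, 2) = 0` for `n < 2`; the first difference is never negative. -/
def upperBoundFun (v : List ℕ) (t : ℕ) : ℕ :=
  (Finset.range (v.length + 1)).inf' Finset.nonempty_range_add_one
    fun i => (t + 2).choose 2 - (t + 2 - i).choose 2 + (v.drop i).sum

/-- A non-increasing vector `v` is GMS if `v_i - v_j ≥ j - i - 1` for all `i < j`. -/
def IsGMS (v : List ℕ) : Prop :=
  v.Pairwise (· ≥ ·) ∧
    ∀ i j : Fin v.length, i < j →
      ((j : ℕ) : ℤ) - ((i : ℕ) : ℤ) - 1 ≤ ((v.get i : ℕ) : ℤ) - ((v.get j : ℕ) : ℤ)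

/-- The standard configuration `S_v`: the first quadrant lattice points `(i, j)` with
`0 ≤ j < r` and `0 ≤ i < v_{j+1}`. -/
def standardConfig (v : List ℕ) : Set (ℕ × ℕ) :=
  {q | ∃ h : q.2 < v.length, q.1 < v.get ⟨q.2, h⟩}

/-- `diag(v)_t` is the number of points of `S_v` on the line `x + y = t`. -/
def diagCount (v : List ℕ) (t : ℕ) : ℕ :=
  Set.ncard {q : ℕ × ℕ | q ∈ standardConfig v ∧ q.1 + q.2 = t}

/-- The summation operator: `(c₀, c₁, …) ↦ (c₀, c₀ + c₁, …)`. -/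
def sumSeq (c : ℕ → ℕ) (t : ℕ) : ℕ :=
  ∑ k ∈ Finset.range (t + 1), c k

/-! ## Line count configurations and the star operator -/

/-- `a ∘ m = (a₁m₁, (a₁-1)m₁, …, m₁, a₂m₂, …, m₂, …, a_sm_s, …, m_s)`. -/
def circVec {s : ℕ} (a m : Fin s → ℕ) : List ℕ :=
  (List.finRange s).flatMap fun i => (List.range (a i)).map fun k => (a i - k) * m i

/-- `a * m`: the entries of `a ∘ m` permuted to be non-increasing. -/
def starVec {s : ℕ} (a m : Fin s → ℕ) : List ℕ :=
  (circVec a m).insertionSort (· ≥ ·)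

/-- `Z₁ + ⋯ + Z_s` is a line count configuration of type `m = (m₁, …, m_s)` corresponding to the
distinct lines `L₁, …, L_s`. -/
structure IsLineCountConfiguration {K : Type*} [Field K] {s : ℕ} (m : Fin s → ℕ)
    (L : Fin s → PlaneLine K) (Z : Fin s → Finset (PlanePoint K)) : Prop where
  lines_distinct : Function.Injective L
  on_line : ∀ i, ∀ p ∈ Z i, OnLine p (L i)
  avoids_intersections : ∀ i, ∀ p ∈ Z i, ∀ j k, j ≠ k → ¬ (OnLine p (L j) ∧ OnLine p (L k))
  card_eq : ∀ i, (Z i).card = m i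

/-- The fat point scheme `Z(a, m) = a₁Z₁ + ⋯ + a_sZ_s`. -/
def weightedScheme {K : Type*} [Field K] {s : ℕ} (a : Fin s → ℕ)
    (Z : Fin s → Finset (PlanePoint K)) : FatPoints K :=
  ∑ i, a i • reducedScheme (Z i)

end

/-! Let `F` define a line `L`. The exact sequence `0 → (R/(I_A : F))(-1) → R/I_A → R/(I_A + (F)) →
0` gives `h_A(t+1) = h_{A:L}(t) + h_{I_A+(F)}(t+1)` (`hilbertFun_succ`). The residual is again a fat
point scheme: multiplicities on `L` drop by one and the others stay (`residualIdeal_ideal`). This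
holds because order of vanishing at a point behaves like a valuation (`mem_pointIdeal_pow_iff`). In
degree `t` the intersection term is at least `min(t+1, d)`, where `d` is the sum of the
multiplicities of `A` on `L`, and at most `t+1`.

Along a sequence of lines that empties the scheme, the lower estimates add up to `f_v`. The upper
estimate for the first `i` lines, followed by "Hilbert function ≤ degree", gives the `i`-th term of
`F_v`. If `v` is GMS, one of these terms is at most `f_v(t)`, so the bounds coincide.

In a line count configuration the points on `L_i` are met by no other line of the configuration.
Removing `L_i` therefore replaces `a_i` by `a_i - 1` and contributes the entry `a_i m_i`. Always
removing a line with the largest `a_i m_i` yields the entries of `a * m` in order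
(`exists_reducesToEmpty`). -/

/-! ### Hilbert functions and the residual exact sequence -/

section HilbertFunction

open MvPolynomial

attribute [local instance] MvPolynomial.gradedAlgebra

variable {K : Type*} [Field K]

/-- An ideal of the coordinate ring is homogeneous for the standard grading. -/
abbrev IsHomIdeal (I : Ideal (CoordRing K)) : Prop :=
  I.IsHomogeneous (homogeneousSubmodule (Fin 3) K)

/-- The degree `t` part of an ideal. -/
noncomputable abbrev degreePart (I : Ideal (CoordRing K)) (t : ℕ) :
    Submodule K (homogeneousSubmodule (Fin 3) K t) :=
  (I.restrictScalars K).comap (homogeneousSubmodule (Fin 3) K t).subtype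

instance finite_homogeneousSubmodule (t : ℕ) :
    Module.Finite K (homogeneousSubmodule (Fin 3) K t) :=
  Module.Finite.iff_fg.mpr (homogeneousSubmodule_fg (Fin 3) K t)

theorem mem_degreePart {I : Ideal (CoordRing K)} {t : ℕ}
    {x : homogeneousSubmodule (Fin 3) K t} : x ∈ degreePart I t ↔ (x : CoordRing K) ∈ I :=
  Iff.rfl

theorem hilbertFun_anti {I J : Ideal (CoordRing K)} (h : I ≤ J) (t : ℕ) :
    hilbertFun J t ≤ hilbertFun I t := by
  have hle : degreePart I t ≤ degreePart J t := fun x hx => h hx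
  exact LinearMap.finrank_le_finrank_of_surjective (f := Submodule.factor hle)
    (Submodule.factor_surjective hle)

theorem hilbertFun_top (t : ℕ) : hilbertFun (⊤ : Ideal (CoordRing K)) t = 0 := by
  have : Subsingleton (homogeneousSubmodule (Fin 3) K t ⧸ degreePart (⊤ : Ideal (CoordRing K)) t) :=
    Submodule.Quotient.subsingleton_iff.mpr (by ext; simp)
  exact Module.finrank_zero_of_subsingleton

/-- Multiplication by a linear form, on forms of degree `t`. -/
noncomputable def mulLinearForm (F : CoordRing K) (hF : F.IsHomogeneous 1) (t : ℕ) :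
    homogeneousSubmodule (Fin 3) K t →ₗ[K] homogeneousSubmodule (Fin 3) K (t + 1) :=
  ((LinearMap.mulLeft K F).comp (homogeneousSubmodule (Fin 3) K t).subtype).codRestrict _
    fun x => by
      have := hF.mul ((mem_homogeneousSubmodule t _).mp x.2)
      rw [add_comm] at this
      exact this

theorem coe_mulLinearForm (F : CoordRing K) (hF : F.IsHomogeneous 1) (t : ℕ)
    (x : homogeneousSubmodule (Fin 3) K t) :
    (mulLinearForm F hF t x : CoordRing K) = F * x := rfl

theorem homogeneousComponent_succ_mul (F G : CoordRing K) (hF : F.IsHomogeneous 1) (t : ℕ) :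
    homogeneousComponent (t + 1) (F * G) = F * homogeneousComponent t G := by
  conv_lhs => rw [← sum_homogeneousComponent G, Finset.mul_sum, map_sum]
  have key : ∀ i, homogeneousComponent (t + 1) (F * homogeneousComponent i G) =
      if i = t then F * homogeneousComponent i G else 0 := by
    intro i
    have hi : F * homogeneousComponent i G ∈ homogeneousSubmodule (Fin 3) K (1 + i) :=
      hF.mul (homogeneousComponent_isHomogeneous i G)
    rw [homogeneousComponent_of_mem hi]
    exact if_congr (by omega) rfl rfl
  simp only [key]
  rw [Finset.sum_ite_eq' (Finset.range (G.totalDegree + 1)) t]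
  split_ifs with h
  · rfl
  · rw [homogeneousComponent_eq_zero, mul_zero]
    simpa using h

/-- The Hilbert functions in the exact sequence
`0 → (R / (I : F))(-1) → R / I → R / (I + (F)) → 0`. -/
theorem hilbertFun_succ {I : Ideal (CoordRing K)} (hI : IsHomIdeal I) {F : CoordRing K}
    (hF : F.IsHomogeneous 1) (t : ℕ) :
    hilbertFun I (t + 1) =
      hilbertFun (Submodule.colon I {F}) t + hilbertFun (I ⊔ Ideal.span {F}) (t + 1) := by
  have hle : degreePart I (t + 1) ≤ degreePart (I ⊔ Ideal.span {F}) (t + 1) :=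
    fun x hx => (le_sup_left : I ≤ I ⊔ Ideal.span {F}) hx
  have hker : LinearMap.ker ((degreePart I (t + 1)).mkQ ∘ₗ mulLinearForm F hF t) =
      degreePart (Submodule.colon I {F}) t := by
    ext x
    rw [LinearMap.mem_ker, LinearMap.comp_apply, Submodule.mkQ_apply,
      Submodule.Quotient.mk_eq_zero, mem_degreePart, mem_degreePart, coe_mulLinearForm,
      Submodule.mem_colon_singleton, smul_eq_mul, mul_comm]
  have hrange : LinearMap.range ((degreePart I (t + 1)).mkQ ∘ₗ mulLinearForm F hF t) =
      LinearMap.ker (Submodule.factor hle) := by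
    ext y
    constructor
    · rintro ⟨x, rfl⟩
      rw [LinearMap.mem_ker, LinearMap.comp_apply, Submodule.mkQ_apply]
      change Submodule.Quotient.mk (mulLinearForm F hF t x) = _
      rw [Submodule.Quotient.mk_eq_zero, mem_degreePart, coe_mulLinearForm]
      exact Ideal.mul_mem_right _ _ (Ideal.mem_sup_right (Ideal.mem_span_singleton_self F))
    · obtain ⟨z, rfl⟩ := Submodule.mkQ_surjective _ y
      intro hz
      rw [LinearMap.mem_ker] at hz
      change Submodule.Quotient.mk z = _ at hz
      rw [Submodule.Quotient.mk_eq_zero, mem_degreePart, Submodule.mem_sup] at hz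
      obtain ⟨u, hu, v, hv, huv⟩ := hz
      obtain ⟨w, rfl⟩ := Ideal.mem_span_singleton.mp hv
      refine ⟨⟨homogeneousComponent t w, homogeneousComponent_isHomogeneous t w⟩, ?_⟩
      rw [LinearMap.comp_apply, Submodule.mkQ_apply, Submodule.mkQ_apply, eq_comm,
        Submodule.Quotient.eq, mem_degreePart, Submodule.coe_sub, coe_mulLinearForm]
      -- The preimage of `z = u + F w` is the degree `t` part of `w`; homogeneity of `I` keeps the
      -- degree `t + 1` part of the error `u` in `I`.
      have h1 := congrArg (homogeneousComponent (t + 1)) huv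
      rw [map_add, homogeneousComponent_succ_mul F w hF,
        homogeneousComponent_eq_self ((mem_homogeneousSubmodule _ _).mp z.2)] at h1
      rw [← h1, add_sub_cancel_right]
      exact homogeneousComponent_mem_of_mem hI hu _
  have e1 := LinearMap.finrank_range_add_finrank_ker (Submodule.factor hle)
  rw [LinearMap.range_eq_top.mpr (Submodule.factor_surjective hle), finrank_top, ← hrange,
    ← ((degreePart I (t + 1)).mkQ ∘ₗ mulLinearForm F hF t).quotKerEquivRange.finrank_eq,
    hker] at e1
  exact e1.symm.trans (add_comm _ _)

theorem isHomogeneous_lineForm (L : PlaneLine K) : (lineForm L).IsHomogeneous 1 :=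
  IsHomogeneous.sum _ _ _ fun _ _ => isHomogeneous_C_mul_X _ _

theorem lineForm_ne_zero (L : PlaneLine K) : lineForm L ≠ 0 := by
  intro h
  refine L.rep_nonzero (funext fun i => ?_)
  have := congrArg (eval (Pi.single i 1)) h
  simpa [lineForm, Pi.single_apply] using this

theorem isHomIdeal_span_singleton {F : CoordRing K} {n : ℕ} (hF : F.IsHomogeneous n) :
    IsHomIdeal (Ideal.span {F}) :=
  Ideal.homogeneous_span _ _ (by rintro x rfl; exact ⟨n, hF⟩)

theorem isHomIdeal_pointIdeal (p : PlanePoint K) : IsHomIdeal (pointIdeal p) :=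
  Ideal.homogeneous_span _ _ (fun _ hx => hx.1)

theorem IsHomIdeal.pow {I : Ideal (CoordRing K)} (hI : IsHomIdeal I) (n : ℕ) :
    IsHomIdeal (I ^ n) := by
  induction n with
  | zero => rw [pow_zero, Ideal.one_eq_top]; exact Ideal.IsHomogeneous.top _
  | succ n ih => rw [pow_succ]; exact ih.mul hI

theorem isHomIdeal_ideal (A : FatPoints K) : IsHomIdeal A.ideal :=
  Ideal.IsHomogeneous.iInf fun p => (isHomIdeal_pointIdeal p).pow _

theorem finrank_homogeneousSubmodule (t : ℕ) :
    Module.finrank K (homogeneousSubmodule (Fin 3) K t) = (t + 2).choose 2 := by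
  rw [homogeneousSubmodule_eq_finsupp_supported]
  have hs : {d : Fin 3 →₀ ℕ | d.degree = t} =
      ((Finset.univ : Finset (Fin 3)).finsuppAntidiag t : Set (Fin 3 →₀ ℕ)) := by
    ext d
    simp [Finset.mem_finsuppAntidiag, Finsupp.degree_eq_sum]
  rw [hs]
  refine (Module.finrank_eq_card_basis (basisRestrictSupport K _)).trans ?_
  simp only [Finset.coe_sort_coe, Fintype.card_coe]
  rw [Finset.card_finsuppAntidiag_nat_eq_choose, Finset.card_univ, Fintype.card_fin,
    show 3 + t - 1 = t + 2 by omega, Nat.choose_symm_add]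

theorem hilbertFun_bot (t : ℕ) : hilbertFun (⊥ : Ideal (CoordRing K)) t = (t + 2).choose 2 := by
  have : degreePart (⊥ : Ideal (CoordRing K)) t = ⊥ := by
    ext x
    simp
  change Module.finrank K (_ ⧸ degreePart (⊥ : Ideal (CoordRing K)) t) = _
  rw [this, (Submodule.quotEquivOfEqBot _ rfl).finrank_eq, finrank_homogeneousSubmodule]

theorem hilbertFun_zero_le_one (I : Ideal (CoordRing K)) : hilbertFun I 0 ≤ 1 :=
  (hilbertFun_anti bot_le 0).trans (hilbertFun_bot 0).le

/-- The exact sequence for the zero ideal: `0 : F = 0`, so the value is a difference of consecutive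
binomials. -/
theorem hilbertFun_span_lineForm_le (L : PlaneLine K) (t : ℕ) :
    hilbertFun (Ideal.span {lineForm L}) t ≤ t + 1 := by
  cases t with
  | zero => exact hilbertFun_zero_le_one _
  | succ t =>
    have h := hilbertFun_succ (Ideal.IsHomogeneous.bot _) (isHomogeneous_lineForm L) t
    have hc : Submodule.colon (⊥ : Ideal (CoordRing K)) {lineForm L} = ⊥ := by
      ext x
      simp [Submodule.mem_colon_singleton, lineForm_ne_zero L]
    rw [hc, bot_sup_eq, hilbertFun_bot, hilbertFun_bot] at h
    have := Nat.choose_succ_succ' (t + 2) 1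
    simp only [Nat.choose_one_right] at this
    rw [show t + 1 + 2 = t + 2 + 1 by ring, this] at h
    simp only [Nat.reduceAdd] at h
    omega

theorem hilbertFun_le_finrank {I : Ideal (CoordRing K)} {t : ℕ} {V : Type*} [AddCommGroup V]
    [Module K V] [Module.Finite K V] (f : homogeneousSubmodule (Fin 3) K t →ₗ[K] V)
    (hf : LinearMap.ker f ≤ degreePart I t) : hilbertFun I t ≤ Module.finrank K V := by
  refine (LinearMap.finrank_le_finrank_of_surjective (f := Submodule.factor hf)
    (Submodule.factor_surjective hf)).trans ?_
  rw [f.quotKerEquivRange.finrank_eq]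
  exact Submodule.finrank_le _

end HilbertFunction

/-! ### Powers of point ideals, residuals, and the degree bound -/

section PointIdeal

open MvPolynomial

attribute [local instance] MvPolynomial.gradedAlgebra

variable {K : Type*} [Field K]

/-- Used with `r` a linear form, where a form vanishing at `q` is killed, and with `r` a scalar,
where vanishing is independent of the representative. -/
theorem MvPolynomial.IsHomogeneous.aeval_smul {σ k S : Type*} [Field k] [CommRing S] [Algebra k S]
    {G : MvPolynomial σ k} {e : ℕ} (hG : G.IsHomogeneous e) (q : σ → k) (r : S) :
    MvPolynomial.aeval (fun i => q i • r) G = MvPolynomial.eval q G • r ^ e := by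
  rw [aeval_def, eval₂_eq, eval_eq, Finset.sum_smul]
  refine Finset.sum_congr rfl fun d hd => ?_
  have hdeg : ∑ i ∈ d.support, d i = e := (hG.degree_eq_sum_deg_support hd).symm
  simp only [smul_pow, Finset.prod_smul, Finset.prod_pow_eq_pow_sum, hdeg]
  rw [mul_smul, Algebra.smul_def (coeff d G)]

/-- The linear form `x_i / q_i`, taking the value `1` at `q`. -/
noncomputable def dualForm (q : Fin 3 → K) (i : Fin 3) : CoordRing K := C (q i)⁻¹ * X i

/-- The linear forms `x_j - q_j ℓ` vanishing at `q`, where `ℓ = x_i / q_i`. -/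
noncomputable def vanishingForm (q : Fin 3 → K) (i j : Fin 3) : CoordRing K :=
  X j - q j • dualForm q i

/-- The substitution `x_j ↦ q_j ℓ + T (x_j - q_j ℓ)`, where `ℓ = x_i / q_i`. It is the identity at
`T = 1`, and the order of vanishing of a form at `q` is the order in `T` of its image. -/
noncomputable def orderHom (q : Fin 3 → K) (i : Fin 3) :
    CoordRing K →ₐ[K] Polynomial (CoordRing K) :=
  aeval fun j => Polynomial.C (q j • dualForm q i) +
    Polynomial.X * Polynomial.C (vanishingForm q i j)

theorem isHomogeneous_dualForm (q : Fin 3 → K) (i : Fin 3) : (dualForm q i).IsHomogeneous 1 :=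
  isHomogeneous_C_mul_X _ _

theorem isHomogeneous_vanishingForm (q : Fin 3 → K) (i j : Fin 3) :
    (vanishingForm q i j).IsHomogeneous 1 := by
  refine (isHomogeneous_X K j).sub ?_
  rw [smul_eq_C_mul]
  exact (isHomogeneous_dualForm q i).C_mul _

theorem vanishingForm_self {q : Fin 3 → K} {i : Fin 3} (hi : q i ≠ 0) :
    vanishingForm q i i = 0 := by
  rw [vanishingForm, dualForm, smul_eq_C_mul, ← mul_assoc, ← C_mul, mul_inv_cancel₀ hi, C_1,
    one_mul, sub_self]

theorem eval_vanishingForm {q : Fin 3 → K} {i : Fin 3} (hi : q i ≠ 0) (j : Fin 3) :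
    eval q (vanishingForm q i j) = 0 := by
  simp [vanishingForm, dualForm, smul_eval, hi]

theorem vanishingForm_mem_pointIdeal (p : PlanePoint K) {i : Fin 3} (hi : p.rep i ≠ 0)
    (j : Fin 3) : vanishingForm p.rep i j ∈ pointIdeal p :=
  Ideal.subset_span ⟨⟨1, isHomogeneous_vanishingForm _ _ _⟩, eval_vanishingForm hi j⟩

theorem orderHom_eval_one (q : Fin 3 → K) (i : Fin 3) (G : CoordRing K) :
    (orderHom q i G).eval 1 = G := by
  have : ((Polynomial.aeval (1 : CoordRing K)).restrictScalars K).comp (orderHom q i) =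
      AlgHom.id K (CoordRing K) := by
    ext j
    simp [orderHom, vanishingForm]
  simpa [Polynomial.aeval_def] using DFunLike.congr_fun this G

theorem orderHom_eval_zero (q : Fin 3 → K) (i : Fin 3) (G : CoordRing K) :
    (orderHom q i G).eval 0 = aeval (fun j => q j • dualForm q i) G := by
  have : ((Polynomial.aeval (0 : CoordRing K)).restrictScalars K).comp (orderHom q i) =
      aeval (fun j => q j • dualForm q i) := by
    ext j
    simp [orderHom]
  simpa [Polynomial.aeval_def] using DFunLike.congr_fun this G

/-- In the image of a variable the coefficient of `T` lies in `I_p`. As the Rees algebra is a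
subalgebra, the coefficient of `T ^ k` in any image lies in `I_p ^ k`. -/
theorem orderHom_mem_reesAlgebra (p : PlanePoint K) {i : Fin 3} (hi : p.rep i ≠ 0)
    (G : CoordRing K) : orderHom p.rep i G ∈ reesAlgebra (pointIdeal p) := by
  induction G using MvPolynomial.induction_on with
  | C a =>
    have : orderHom p.rep i (C a) = algebraMap (CoordRing K) _ (C a) := by
      rw [← algebraMap_eq, AlgHom.commutes]
      rfl
    rw [this]
    exact Subalgebra.algebraMap_mem _ _
  | add G H hG hH => rw [map_add]; exact add_mem hG hH
  | mul_X G j hG =>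
    rw [map_mul]
    refine mul_mem hG ?_
    rw [orderHom, aeval_X]
    refine add_mem (Subalgebra.algebraMap_mem _ _) ?_
    rw [mul_comm, ← pow_one Polynomial.X, Polynomial.C_mul_X_pow_eq_monomial]
    exact reesAlgebra.monomial_mem.mpr (by simpa using vanishingForm_mem_pointIdeal p hi j)

theorem X_dvd_orderHom (p : PlanePoint K) {i : Fin 3} {G : CoordRing K}
    (hG : G ∈ pointIdeal p) : Polynomial.X ∣ orderHom p.rep i G := by
  rw [Polynomial.X_dvd_iff, Polynomial.coeff_zero_eq_eval_zero, orderHom_eval_zero]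
  change G ∈ RingHom.ker (aeval (fun j => p.rep j • dualForm p.rep i) : CoordRing K →ₐ[K] _)
  revert G
  change pointIdeal p ≤ _
  refine Ideal.span_le.mpr ?_
  rintro G ⟨⟨e, he⟩, h0⟩
  rw [SetLike.mem_coe, RingHom.mem_ker, he.aeval_smul, h0, zero_smul]

/-- Setting `T = 1` recovers `G` as the sum of its coefficients, the `k`-th one in `I_p ^ k`;
conversely `I_p` maps into `(T)`. Since `T` is prime, colon ideals become cancellation problems. -/
theorem mem_pointIdeal_pow_iff (p : PlanePoint K) {i : Fin 3} (hi : p.rep i ≠ 0)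
    (G : CoordRing K) (n : ℕ) :
    G ∈ pointIdeal p ^ n ↔ Polynomial.X ^ n ∣ orderHom p.rep i G := by
  constructor
  · intro hG
    rw [← Ideal.mem_span_singleton, ← Ideal.span_singleton_pow]
    have hle : pointIdeal p ≤ (Ideal.span {Polynomial.X}).comap (orderHom p.rep i) :=
      fun x hx => Ideal.mem_span_singleton.mpr (X_dvd_orderHom p hx)
    exact (Ideal.pow_right_mono hle n).trans (Ideal.le_comap_pow _ n) hG
  · intro hG
    rw [Polynomial.X_pow_dvd_iff] at hG
    have h1 := orderHom_eval_one p.rep i G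
    rw [Polynomial.eval_eq_sum_range] at h1
    rw [← h1]
    refine Ideal.sum_mem _ fun k _ => ?_
    rw [one_pow, mul_one]
    rcases lt_or_ge k n with hk | hk
    · rw [hG k hk]
      exact Ideal.zero_mem _
    · exact Ideal.pow_le_pow_right hk (orderHom_mem_reesAlgebra p hi G k)

/-- The constant coefficient is the value at `q` times a linear form, so a line through `q` has
order exactly one and any other line order zero. -/
theorem orderHom_lineForm (L : PlaneLine K) (q : Fin 3 → K) (i : Fin 3) :
    orderHom q i (lineForm L) = Polynomial.C ((L.rep ⬝ᵥ q) • dualForm q i) +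
      Polynomial.X * Polynomial.C (lineForm L - (L.rep ⬝ᵥ q) • dualForm q i) := by
  simp only [lineForm, orderHom, vanishingForm, map_mul, map_add, aeval_X, aeval_C,
    dotProduct, Fin.sum_univ_three, smul_eq_C_mul, map_sub, Polynomial.algebraMap_apply,
    algebraMap_eq, mul_sub, mul_add]
  ring

theorem onLine_iff (p : PlanePoint K) (L : PlaneLine K) : OnLine p L ↔ L.rep ⬝ᵥ p.rep = 0 := by
  conv_lhs => rw [OnLine, ← L.mk_rep, ← p.mk_rep]
  exact Projectivization.orthogonal_mk _ _

theorem exists_rep_ne_zero (p : PlanePoint K) : ∃ i, p.rep i ≠ 0 :=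
  Function.ne_iff.mp p.rep_nonzero

theorem dualForm_ne_zero {q : Fin 3 → K} {i : Fin 3} (hi : q i ≠ 0) : dualForm q i ≠ 0 :=
  mul_ne_zero (C_ne_zero.mpr (inv_ne_zero hi)) (X_ne_zero i)

theorem colon_pointIdeal_pow_of_onLine {p : PlanePoint K} {L : PlaneLine K} (h : OnLine p L)
    (n : ℕ) : Submodule.colon (pointIdeal p ^ n) {lineForm L} = pointIdeal p ^ (n - 1) := by
  obtain ⟨i, hi⟩ := exists_rep_ne_zero p
  cases n with
  | zero => simp [Ideal.one_eq_top]
  | succ n =>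
    ext G
    rw [Submodule.mem_colon_singleton, smul_eq_mul, mem_pointIdeal_pow_iff p hi,
      mem_pointIdeal_pow_iff p hi, map_mul, orderHom_lineForm, (onLine_iff p L).mp h, zero_smul,
      map_zero, zero_add, sub_zero, Nat.add_sub_cancel, pow_succ', mul_left_comm,
      mul_dvd_mul_iff_left Polynomial.X_ne_zero]
    constructor
    · intro hd
      refine Polynomial.prime_X.pow_dvd_of_dvd_mul_right n ?_ hd
      rw [Polynomial.X_dvd_iff, Polynomial.coeff_C_zero]
      exact lineForm_ne_zero L
    · exact fun hd => hd.mul_right _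

theorem colon_pointIdeal_pow_of_not_onLine {p : PlanePoint K} {L : PlaneLine K}
    (h : ¬ OnLine p L) (n : ℕ) :
    Submodule.colon (pointIdeal p ^ n) {lineForm L} = pointIdeal p ^ n := by
  obtain ⟨i, hi⟩ := exists_rep_ne_zero p
  ext G
  rw [Submodule.mem_colon_singleton, smul_eq_mul, mem_pointIdeal_pow_iff p hi,
    mem_pointIdeal_pow_iff p hi, map_mul]
  constructor
  · intro hd
    refine Polynomial.prime_X.pow_dvd_of_dvd_mul_right n ?_ hd
    rw [orderHom_lineForm, Polynomial.X_dvd_iff]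
    simpa using ⟨fun h0 => h ((onLine_iff p L).mpr h0), dualForm_ne_zero hi⟩
  · exact fun hd => hd.mul_right _

open Classical in
/-- The residual scheme `A : L`. -/
noncomputable def FatPoints.residual (A : FatPoints K) (L : PlaneLine K) : FatPoints K :=
  Finsupp.onFinset A.support (fun p => if OnLine p L then A p - 1 else A p) fun p hp => by
    rw [Finsupp.mem_support_iff]
    rintro h0
    simp [h0] at hp

open Classical in
theorem FatPoints.residual_apply (A : FatPoints K) (L : PlaneLine K) (p : PlanePoint K) :
    A.residual L p = if OnLine p L then A p - 1 else A p := rfl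

/-- Colon by `F` commutes with intersections, so the computation is local at each point. -/
theorem residualIdeal_ideal (A : FatPoints K) (L : PlaneLine K) :
    residualIdeal A.ideal L = (A.residual L).ideal := by
  rw [residualIdeal, FatPoints.ideal, Submodule.iInf_colon, FatPoints.ideal]
  refine iInf_congr fun p => ?_
  rw [FatPoints.residual_apply]
  split_ifs with h
  · exact colon_pointIdeal_pow_of_onLine h _
  · exact colon_pointIdeal_pow_of_not_onLine h _

/-- Modulo the vanishing linear forms every variable `x_l` becomes `q_l ℓ`, so a form `G` of degree
`e` becomes `G(q) ℓ ^ e`, which is zero. -/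
theorem exists_pointIdeal_eq_span_pair (p : PlanePoint K) :
    ∃ F G : CoordRing K, F.IsHomogeneous 1 ∧ G.IsHomogeneous 1 ∧
      pointIdeal p = Ideal.span {F, G} := by
  obtain ⟨i, hi⟩ := exists_rep_ne_zero p
  obtain ⟨j, k, hjk⟩ : ∃ j k : Fin 3, ∀ l, l = i ∨ l = j ∨ l = k := by
    clear hi; revert i; decide
  set J : Ideal (CoordRing K) := Ideal.span {vanishingForm p.rep i j, vanishingForm p.rep i k}
    with hJ
  refine ⟨_, _, isHomogeneous_vanishingForm p.rep i j, isHomogeneous_vanishingForm p.rep i k,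
    le_antisymm (Ideal.span_le.mpr ?_) (Ideal.span_le.mpr ?_)⟩
  · rintro G ⟨⟨e, he⟩, h0⟩
    have hmem : ∀ l, vanishingForm p.rep i l ∈ J := by
      intro l
      rcases hjk l with rfl | rfl | rfl
      · rw [vanishingForm_self hi]; exact Ideal.zero_mem _
      · exact Ideal.subset_span (by simp)
      · exact Ideal.subset_span (by simp)
    have hcomp : (Ideal.Quotient.mkₐ K J).comp (aeval fun l => p.rep l • dualForm p.rep i) =
        Ideal.Quotient.mkₐ K J := by
      refine MvPolynomial.algHom_ext fun l => ?_
      rw [AlgHom.comp_apply, aeval_X, Ideal.Quotient.mkₐ_eq_mk, eq_comm, Ideal.Quotient.eq]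
      exact hmem l
    have := DFunLike.congr_fun hcomp G
    rw [AlgHom.comp_apply, he.aeval_smul, h0, zero_smul, map_zero, Ideal.Quotient.mkₐ_eq_mk,
      eq_comm, Ideal.Quotient.eq_zero_iff_mem] at this
    exact this
  · rintro G (rfl | rfl) <;> exact vanishingForm_mem_pointIdeal p hi _

theorem hilbertFun_pointIdeal_le (p : PlanePoint K) (t : ℕ) : hilbertFun (pointIdeal p) t ≤ 1 := by
  have := hilbertFun_le_finrank (I := pointIdeal p)
    ((aeval p.rep : CoordRing K →ₐ[K] K).toLinearMap ∘ₗ (homogeneousSubmodule (Fin 3) K t).subtype)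
    fun x hx => Ideal.subset_span ⟨⟨t, x.2⟩, hx⟩
  rwa [Module.finrank_self] at this

/-- Cutting `I_p ^ (n+1) + (F)` by `G` leaves a residual containing `I_p ^ n + (F)` and a sum
containing `I_p`, so each step costs at most one condition. -/
theorem hilbertFun_pointIdeal_pow_sup_le (p : PlanePoint K) {F G : CoordRing K}
    (hF : F.IsHomogeneous 1) (hG : G.IsHomogeneous 1) (hp : pointIdeal p = Ideal.span {F, G})
    (n t : ℕ) : hilbertFun (pointIdeal p ^ n ⊔ Ideal.span {F}) t ≤ n := by
  have hGp : G ∈ pointIdeal p := hp ▸ Ideal.subset_span (by simp)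
  induction n generalizing t with
  | zero => rw [pow_zero, Ideal.one_eq_top, top_sup_eq, hilbertFun_top]
  | succ n ih =>
    cases t with
    | zero => exact (hilbertFun_zero_le_one _).trans (by omega)
    | succ t =>
      rw [hilbertFun_succ (((isHomIdeal_pointIdeal p).pow _).sup (isHomIdeal_span_singleton hF)) hG]
      refine add_le_add ((hilbertFun_anti ?_ t).trans (ih t))
        ((hilbertFun_anti ?_ _).trans (hilbertFun_pointIdeal_le p _))
      · refine sup_le (fun x hx => ?_) (le_sup_right.trans Ideal.le_colon)
        rw [Submodule.mem_colon_singleton, smul_eq_mul]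
        exact Ideal.mem_sup_left (Ideal.mul_mem_mul hx hGp)
      · rw [hp, Ideal.span_insert]
        exact sup_le_sup_right le_sup_right _

/-- Cutting repeatedly by `F` gives at most `n + (n-1) + ⋯ + 1` conditions. -/
theorem hilbertFun_pointIdeal_pow_le (p : PlanePoint K) (n t : ℕ) :
    hilbertFun (pointIdeal p ^ n) t ≤ (n + 1).choose 2 := by
  obtain ⟨F, G, hF, hG, hp⟩ := exists_pointIdeal_eq_span_pair p
  have hFp : F ∈ pointIdeal p := hp ▸ Ideal.subset_span (by simp)
  induction n generalizing t with
  | zero => rw [pow_zero, Ideal.one_eq_top, hilbertFun_top]; exact Nat.zero_le _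
  | succ n ih =>
    have hc : (n + 1 + 1).choose 2 = (n + 1) + (n + 1).choose 2 := by
      rw [Nat.choose_succ_succ' (n + 1) 1, Nat.choose_one_right]
    rw [hc]
    cases t with
    | zero => exact (hilbertFun_zero_le_one _).trans (by omega)
    | succ t =>
      rw [hilbertFun_succ ((isHomIdeal_pointIdeal p).pow _) hF, add_comm]
      refine add_le_add (hilbertFun_pointIdeal_pow_sup_le p hF hG hp _ _)
        ((hilbertFun_anti (fun x hx => ?_) t).trans (ih t))
      rw [Submodule.mem_colon_singleton, smul_eq_mul]
      exact Ideal.mul_mem_mul hx hFp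

/-- The degree of a fat point scheme. -/
noncomputable def FatPoints.degree (A : FatPoints K) : ℕ := A.sum fun _ n => (n + 1).choose 2

theorem Submodule.finrank_quotient_iInf_le {k V ι : Type*} [Field k] [AddCommGroup V] [Module k V]
    [Module.Finite k V] [Fintype ι] (N : ι → Submodule k V) :
    Module.finrank k (V ⧸ ⨅ i, N i) ≤ ∑ i, Module.finrank k (V ⧸ N i) := by
  have hker : LinearMap.ker (LinearMap.pi fun i => (N i).mkQ) = ⨅ i, N i := by
    rw [LinearMap.ker_pi]
    simp
  rw [← hker, (LinearMap.quotKerEquivRange _).finrank_eq, ← Module.finrank_pi_fintype]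
  exact Submodule.finrank_le _

theorem hilbertFun_ideal_le_degree (A : FatPoints K) (t : ℕ) :
    hilbertFun A.ideal t ≤ A.degree := by
  have heq : degreePart A.ideal t =
      ⨅ p : {p // p ∈ A.support}, degreePart (pointIdeal p.1 ^ A p.1) t := by
    ext x
    rw [mem_degreePart, FatPoints.ideal, Submodule.mem_iInf, Submodule.mem_iInf]
    refine ⟨fun h p => h p.1, fun h p => ?_⟩
    by_cases hp : p ∈ A.support
    · exact h ⟨p, hp⟩
    · rw [Finsupp.notMem_support_iff.mp hp, pow_zero, Ideal.one_eq_top]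
      exact Submodule.mem_top
  change Module.finrank K (_ ⧸ degreePart A.ideal t) ≤ _
  rw [heq, FatPoints.degree, Finsupp.sum, ← Finset.sum_coe_sort]
  exact (Submodule.finrank_quotient_iInf_le _).trans
    (Finset.sum_le_sum fun p _ => hilbertFun_pointIdeal_pow_le p.1 _ t)

end PointIdeal

/-! ### Intersection with a line and degrees -/

section Intersection

open MvPolynomial

attribute [local instance] MvPolynomial.gradedAlgebra

variable {K : Type*} [Field K]

/-- Restriction of forms to the line through `q₀` and `q₁`, in the coordinate `X` for which
`q₀ + X q₁` is the general point. -/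
noncomputable def restrictHom (q₀ q₁ : Fin 3 → K) : CoordRing K →ₐ[K] Polynomial K :=
  aeval fun i => Polynomial.C (q₀ i) + Polynomial.X * Polynomial.C (q₁ i)

theorem eval_restrictHom (q₀ q₁ : Fin 3 → K) (c : K) (G : CoordRing K) :
    (restrictHom q₀ q₁ G).eval c = eval (fun i => q₀ i + c * q₁ i) G := by
  have : (Polynomial.aeval c).comp (restrictHom q₀ q₁) =
      aeval (fun i => q₀ i + c * q₁ i) := by
    ext i
    simp [restrictHom]
    exact mul_comm _ _
  have h := DFunLike.congr_fun this G
  rwa [AlgHom.comp_apply, Polynomial.coe_aeval_eq_eval, aeval_eq_eval] at h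

theorem X_sub_C_pow_dvd_restrictHom {p : PlanePoint K} {q₀ q₁ : Fin 3 → K} {u c : K}
    (hp : ∀ i, p.rep i = (q₀ i + c * q₁ i) * u) {n : ℕ} {G : CoordRing K}
    (hG : G ∈ pointIdeal p ^ n) : (Polynomial.X - Polynomial.C c) ^ n ∣ restrictHom q₀ q₁ G := by
  have hu : u ≠ 0 := by
    rintro rfl
    exact p.rep_nonzero (funext fun i => by simpa using hp i)
  rw [← Ideal.mem_span_singleton, ← Ideal.span_singleton_pow]
  have hle : pointIdeal p ≤
      (Ideal.span {Polynomial.X - Polynomial.C c}).comap (restrictHom q₀ q₁) := by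
    refine Ideal.span_le.mpr ?_
    rintro H ⟨⟨e, he⟩, h0⟩
    rw [SetLike.mem_coe, Ideal.mem_comap, Ideal.mem_span_singleton, Polynomial.dvd_iff_isRoot,
      Polynomial.IsRoot, eval_restrictHom]
    have := he.aeval_smul (fun i => q₀ i + c * q₁ i) u
    simp only [smul_eq_mul, ← hp] at this
    change eval p.rep H = _ at this
    rw [h0, eq_comm] at this
    exact (mul_eq_zero.mp this).resolve_right (pow_ne_zero _ hu)
  exact (Ideal.pow_right_mono hle n).trans (Ideal.le_comap_pow _ n) hG

open Classical in
/-- The degree of the intersection of a fat point scheme with a line. -/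
noncomputable def FatPoints.lineDegree (A : FatPoints K) (L : PlaneLine K) : ℕ :=
  ∑ p ∈ A.support with OnLine p L, A p

/-- A parametrization `q₀ + X q₁` of a line whose point at infinity avoids a given finite set of
points, together with the dual linear forms. -/
theorem exists_line_parametrization [Infinite K] (L : PlaneLine K)
    (S : Finset (PlanePoint K)) :
    ∃ (q₀ q₁ : Fin 3 → K) (g₀ g₁ : CoordRing K), g₀.IsHomogeneous 1 ∧ g₁.IsHomogeneous 1 ∧
      restrictHom q₀ q₁ g₀ = 1 ∧ restrictHom q₀ q₁ g₁ = Polynomial.X ∧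
      restrictHom q₀ q₁ (lineForm L) = 0 ∧
      ∀ p ∈ S, OnLine p L → ∃ c u : K, ∀ i, p.rep i = (q₀ i + c * q₁ i) * u := by
  classical
  obtain ⟨i, hi⟩ := exists_rep_ne_zero L
  obtain ⟨j, k, hij, hik, hjk, hex⟩ : ∃ j k : Fin 3, i ≠ j ∧ i ≠ k ∧ j ≠ k ∧
      ∀ l, l = i ∨ l = j ∨ l = k := by
    clear hi; revert i; decide
  -- On `L` the coordinates `x_j, x_k` determine the point. Avoiding the finitely many ratios `x_j /
  -- x_k` keeps `x_j - b x_k` nonzero on `S`; this needs `K` infinite.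
  obtain ⟨b, hb⟩ := Infinite.exists_notMem_finset (S.image fun p => p.rep j / p.rep k)
  have hsum : ∀ f : Fin 3 → K, ∑ l, f l = f i + f j + f k := by
    intro f
    have huniv : (Finset.univ : Finset (Fin 3)) = {i, j, k} := by
      ext l
      simpa using hex l
    rw [huniv, Finset.sum_insert (by simp [hij, hik]), Finset.sum_pair hjk, add_assoc]
  set c := L.rep with hc
  let v₀ : Fin 3 → K := Function.update (Pi.single j 1) i (-(c j / c i))
  let v₁ : Fin 3 → K := Function.update (Pi.single k 1) i (-(c k / c i))
  have v₀i : v₀ i = -(c j / c i) := by simp [v₀]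
  have v₀j : v₀ j = 1 := by simp [v₀, hij.symm]
  have v₀k : v₀ k = 0 := by simp [v₀, hik.symm, hjk.symm]
  have v₁i : v₁ i = -(c k / c i) := by simp [v₁]
  have v₁j : v₁ j = 0 := by simp [v₁, hij.symm, hjk]
  have v₁k : v₁ k = 1 := by simp [v₁, hik.symm]
  refine ⟨v₀, b • v₀ + v₁, X j - C b * X k, X k,
    (isHomogeneous_X K j).sub (isHomogeneous_C_mul_X b k), isHomogeneous_X K k, ?_, ?_, ?_, ?_⟩
  · simp only [restrictHom, map_sub, map_mul, aeval_X, algHom_C, Pi.add_apply, Pi.smul_apply,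
      smul_eq_mul, v₀j, v₀k, v₁j, v₁k, Polynomial.algebraMap_eq]
    simp only [map_one, map_zero, mul_zero, mul_one, add_zero, zero_add]
    ring
  · simp [restrictHom, v₀k, v₁k]
  · have h0 : c ⬝ᵥ v₀ = 0 := by
      rw [dotProduct, hsum, v₀i, v₀j, v₀k]
      field_simp
      ring
    have h1 : c ⬝ᵥ v₁ = 0 := by
      rw [dotProduct, hsum, v₁i, v₁j, v₁k]
      field_simp
      ring
    have : restrictHom v₀ (b • v₀ + v₁) (lineForm L) = Polynomial.C (c ⬝ᵥ v₀) +
        Polynomial.X * Polynomial.C (b * (c ⬝ᵥ v₀) + c ⬝ᵥ v₁) := by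
      simp only [lineForm, restrictHom, map_add, map_mul, aeval_X, algHom_C, dotProduct,
        Fin.sum_univ_three, Pi.add_apply, Pi.smul_apply, smul_eq_mul, Polynomial.algebraMap_eq]
      ring
    rw [this, h0, h1]
    simp
  · intro p hp hpL
    rw [onLine_iff, dotProduct, hsum] at hpL
    set x := p.rep with hx
    have hxi : x i = -(c j / c i) * x j - (c k / c i) * x k := by
      field_simp
      linear_combination hpL
    have hu : x j - b * x k ≠ 0 := by
      intro h
      by_cases hk : x k = 0
      · have hj : x j = 0 := by simpa [hk] using h
        refine p.rep_nonzero (funext fun l => ?_)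
        rcases hex l with rfl | rfl | rfl
        · rw [← hx, hxi, hj, hk]; simp
        · exact hj
        · exact hk
      · refine hb (Finset.mem_image.mpr ⟨p, hp, ?_⟩)
        rw [div_eq_iff hk]
        linear_combination h
    -- From `x = x_j v₀ + x_k v₁ = (x_j - b x_k) v₀ + x_k (b v₀ + v₁)`.
    refine ⟨x k / (x j - b * x k), x j - b * x k, fun l => ?_⟩
    rw [add_mul, mul_right_comm, div_mul_cancel₀ _ hu]
    simp only [Pi.add_apply, Pi.smul_apply, smul_eq_mul]
    rcases hex l with rfl | rfl | rfl
    · rw [hxi, v₀i, v₁i]; ring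
    · rw [v₀j, v₁j]; ring
    · rw [v₀k, v₁k]; ring

/-- On `L`, elements of `I_A + (F)` restrict to multiples of a monic `H` whose degree is the sum of
the multiplicities on `L`. The forms `g₀ ^ (t-j) g₁ ^ j` restrict to `X ^ j`, so those with `j`
below that degree are independent modulo the ideal. -/
theorem min_le_hilbertFun_intersectionIdeal [Infinite K] (A : FatPoints K) (L : PlaneLine K)
    (t : ℕ) : min (t + 1) (A.lineDegree L) ≤ hilbertFun (intersectionIdeal A.ideal L) t := by
  classical
  obtain ⟨q₀, q₁, g₀, g₁, hg₀, hg₁, hr₀, hr₁, hrL, hpar⟩ :=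
    exists_line_parametrization L A.support
  choose! c u hcu using hpar
  set S := A.support.filter fun p => OnLine p L with hS
  let H : Polynomial K := ∏ p ∈ S, (Polynomial.X - Polynomial.C (c p)) ^ A p
  have hmem : ∀ p ∈ S, ∀ i, p.rep i = (q₀ i + c p * q₁ i) * u p := fun p hp =>
    hcu p (Finset.mem_filter.mp hp).1 (Finset.mem_filter.mp hp).2
  have hinj : ∀ p ∈ S, ∀ p' ∈ S, c p = c p' → p = p' := by
    intro p hp p' hp' h
    have hu : u p' ≠ 0 := by
      intro h0
      exact p'.rep_nonzero (funext fun i => by rw [hmem p' hp' i, h0, mul_zero]; rfl)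
    rw [← p.mk_rep, ← p'.mk_rep, Projectivization.mk_eq_mk_iff']
    refine ⟨u p / u p', funext fun i => ?_⟩
    rw [Pi.smul_apply, smul_eq_mul, hmem p hp i, hmem p' hp' i, h]
    field_simp
  have hdvd : ∀ G ∈ intersectionIdeal A.ideal L, H ∣ restrictHom q₀ q₁ G := by
    intro G hG
    obtain ⟨x, hx, y, hy, rfl⟩ := Submodule.mem_sup.mp hG
    obtain ⟨z, rfl⟩ := Ideal.mem_span_singleton.mp hy
    rw [map_add, map_mul, hrL, zero_mul, add_zero]
    refine Finset.prod_dvd_of_coprime (fun p hp p' hp' hne => ?_) fun p hp => ?_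
    · exact (Polynomial.isCoprime_X_sub_C_of_isUnit_sub
        (sub_ne_zero.mpr fun h => hne (hinj p hp p' hp' h)).isUnit).pow
    · exact X_sub_C_pow_dvd_restrictHom (hmem p hp) ((Submodule.mem_iInf _).mp hx p)
  have hmonic : H.Monic := Polynomial.monic_prod_of_monic _ _ fun p _ =>
    (Polynomial.monic_X_sub_C _).pow _
  have hdeg : H.natDegree = A.lineDegree L := by
    rw [Polynomial.natDegree_prod_of_monic _ _ fun p _ => (Polynomial.monic_X_sub_C _).pow _]
    exact Finset.sum_congr rfl fun p _ => by
      rw [Polynomial.natDegree_pow, Polynomial.natDegree_X_sub_C, mul_one]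
  let w : Fin (min (t + 1) (A.lineDegree L)) → homogeneousSubmodule (Fin 3) K t := fun j =>
    ⟨g₀ ^ (t - j) * g₁ ^ (j : ℕ), by
      have h := (hg₀.pow (t - j)).mul (hg₁.pow j)
      have hj : (j : ℕ) < t + 1 := j.2.trans_le (min_le_left _ _)
      rwa [show 1 * (t - j) + 1 * j = t by omega] at h⟩
  have hli : LinearIndependent K
      ((degreePart (intersectionIdeal A.ideal L) t).mkQ ∘ w) := by
    rw [Fintype.linearIndependent_iff]
    intro a ha
    have h1 : (∑ j, a j • w j) ∈ degreePart (intersectionIdeal A.ideal L) t := by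
      rw [← Submodule.Quotient.mk_eq_zero, ← Submodule.mkQ_apply, map_sum]
      simpa using ha
    have h2 := hdvd _ h1
    have h3 : restrictHom q₀ q₁ ((∑ j, a j • w j : homogeneousSubmodule (Fin 3) K t) :
        CoordRing K) = ∑ j, Polynomial.C (a j) * Polynomial.X ^ (j : ℕ) := by
      rw [Submodule.coe_sum, map_sum]
      refine Finset.sum_congr rfl fun j _ => ?_
      simp [w, hr₀, hr₁, Polynomial.smul_eq_C_mul]
    erw [h3] at h2
    have h4 : ∑ j, Polynomial.C (a j) * Polynomial.X ^ (j : ℕ) = 0 := by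
      refine Polynomial.eq_zero_of_dvd_of_degree_lt h2 ?_
      rw [Polynomial.degree_eq_natDegree hmonic.ne_zero, hdeg]
      refine (Polynomial.degree_sum_fin_lt a).trans_le ?_
      exact_mod_cast min_le_right _ _
    intro j
    have h5 := congrArg (Polynomial.coeff · (j : ℕ)) h4
    simpa [Polynomial.finsetSum_coeff, Polynomial.coeff_X_pow, Fin.val_inj] using h5
  have hcard := hli.fintype_card_le_finrank
  rwa [Fintype.card_fin] at hcard

/-- At each point of the line, `binom(n+1, 2) - binom(n, 2) = n`. -/
theorem FatPoints.degree_residual_add (A : FatPoints K) (L : PlaneLine K) :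
    A.degree = (A.residual L).degree + A.lineDegree L := by
  classical
  have h : (A.residual L).degree = ∑ p ∈ A.support, (A.residual L p + 1).choose 2 :=
    Finsupp.sum_of_support_subset _ Finsupp.support_onFinset_subset _ (by simp)
  rw [h, FatPoints.degree, Finsupp.sum, FatPoints.lineDegree, Finset.sum_filter,
    ← Finset.sum_add_distrib]
  refine Finset.sum_congr rfl fun p hp => ?_
  rw [FatPoints.residual_apply]
  split_ifs with hL
  · obtain ⟨n, hn⟩ := Nat.exists_eq_succ_of_ne_zero (Finsupp.mem_support_iff.mp hp)
    rw [hn, Nat.succ_eq_add_one, Nat.add_sub_cancel, Nat.choose_succ_succ' (n + 1) 1,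
      Nat.choose_one_right, add_comm]
  · rfl

theorem hilbertFun_ideal_succ (A : FatPoints K) (L : PlaneLine K) (t : ℕ) :
    hilbertFun A.ideal (t + 1) = hilbertFun (A.residual L).ideal t +
      hilbertFun (intersectionIdeal A.ideal L) (t + 1) := by
  rw [hilbertFun_succ (isHomIdeal_ideal A) (isHomogeneous_lineForm L), ← residualIdeal_ideal]
  rfl

theorem FatPoints.eq_zero_of_degree_eq_zero {A : FatPoints K} (h : A.degree = 0) : A = 0 := by
  by_contra hA
  obtain ⟨p, hp⟩ := Finsupp.support_nonempty_iff.mpr hA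
  have := (Finset.sum_eq_zero_iff.mp h) p hp
  have hp0 := Finsupp.mem_support_iff.mp hp
  rw [Nat.choose_eq_zero_iff] at this
  omega

theorem FatPoints.ideal_zero : (0 : FatPoints K).ideal = ⊤ := by
  simp [FatPoints.ideal, Ideal.one_eq_top]

theorem exists_onLine (p : PlanePoint K) : ∃ L : PlaneLine K, OnLine p L := by
  obtain ⟨i, hi⟩ := exists_rep_ne_zero p
  obtain ⟨j, hj⟩ : ∃ j, j ≠ i := exists_ne i
  have hv : Pi.single j (p.rep i) - Pi.single i (p.rep j) ≠ (0 : Fin 3 → K) := by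
    intro h
    have := congrFun h j
    simp [hj, hi] at this
  refine ⟨Projectivization.mk K _ hv, ?_⟩
  rw [OnLine]
  conv => arg 2; rw [← p.mk_rep]
  rw [Projectivization.orthogonal_mk, sub_dotProduct, single_dotProduct, single_dotProduct]
  ring

/-- Induct on the degree through a line meeting the support. For large `t`, the residual and the
intersection bound `h_A` below by the degree, which is also an upper bound. -/
theorem hasFiniteDegree_ideal [Infinite K] (A : FatPoints K) : HasFiniteDegree A.ideal A.degree := by
  induction hn : A.degree using Nat.strong_induction_on generalizing A with
  | _ n ih =>
    subst hn
    rcases Nat.eq_zero_or_pos A.degree with h0 | hpos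
    · refine ⟨0, fun t _ => ?_⟩
      rw [FatPoints.eq_zero_of_degree_eq_zero h0, FatPoints.ideal_zero, hilbertFun_top]
      rfl
    · obtain ⟨p, hp⟩ : A.support.Nonempty := by
        rw [Finsupp.support_nonempty_iff]
        rintro rfl
        exact hpos.ne' rfl
      obtain ⟨L, hL⟩ := exists_onLine p
      have hlt : 0 < A.lineDegree L := by
        classical
        exact Finset.sum_pos' (fun _ _ => Nat.zero_le _) ⟨p, Finset.mem_filter.mpr ⟨hp, hL⟩,
          Nat.pos_of_ne_zero (Finsupp.mem_support_iff.mp hp)⟩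
      have hadd := A.degree_residual_add L
      obtain ⟨t₀, ht₀⟩ := ih _ (by omega) (A.residual L) rfl
      refine ⟨t₀ + A.lineDegree L + 1, fun t ht => ?_⟩
      obtain ⟨t, rfl⟩ : ∃ t', t = t' + 1 := ⟨t - 1, by omega⟩
      have h1 := hilbertFun_ideal_succ A L t
      have h2 := hilbertFun_ideal_le_degree A (t + 1)
      have h3 := min_le_hilbertFun_intersectionIdeal A L (t + 1)
      rw [min_eq_right (by omega)] at h3
      rw [ht₀ t (by omega)] at h1
      omega

theorem hasFiniteDegree_intersectionIdeal [Infinite K] (A : FatPoints K) (L : PlaneLine K) :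
    HasFiniteDegree (intersectionIdeal A.ideal L) (A.lineDegree L) := by
  obtain ⟨t₁, ht₁⟩ := hasFiniteDegree_ideal A
  obtain ⟨t₂, ht₂⟩ := hasFiniteDegree_ideal (A.residual L)
  refine ⟨t₁ + t₂ + 1, fun t ht => ?_⟩
  obtain ⟨t, rfl⟩ : ∃ t', t = t' + 1 := ⟨t - 1, by omega⟩
  have h1 := hilbertFun_ideal_succ A L t
  have hadd := A.degree_residual_add L
  rw [ht₁ _ (by omega), ht₂ _ (by omega)] at h1
  omega

end Intersection

/-! ### Bounds from a reduction to the empty scheme -/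

section ReductionVectors

variable {K : Type*} [Field K]

/-- Reduction of a fat point scheme to the empty scheme by successive residuals, recorded on the
level of multiplicities. -/
inductive ReducesToEmpty : FatPoints K → List (PlaneLine K) → List ℕ → Prop
  | nil : ReducesToEmpty 0 [] []
  | cons {A : FatPoints K} {L : PlaneLine K} {Ls : List (PlaneLine K)} {ds : List ℕ}
      (h : ReducesToEmpty (A.residual L) Ls ds) :
      ReducesToEmpty A (L :: Ls) (A.lineDegree L :: ds)

theorem ReducesToEmpty.totallyReducesWith [Infinite K] {A : FatPoints K}
    {Ls : List (PlaneLine K)} {ds : List ℕ} (h : ReducesToEmpty A Ls ds) :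
    TotallyReducesWith A.ideal Ls ds := by
  induction h with
  | nil => exact FatPoints.ideal_zero
  | @cons A L Ls ds _ ih =>
    refine ⟨hasFiniteDegree_intersectionIdeal A L, ?_⟩
    rwa [residualIdeal_ideal]

/-- The sum `∑ max(0, min(n - i, v_{i+1}))`. -/
def truncatedSum (v : List ℕ) (n : ℕ) : ℕ := ∑ i : Fin v.length, min (n - (i : ℕ)) (v.get i)

theorem truncatedSum_cons (d : ℕ) (ds : List ℕ) (n : ℕ) :
    truncatedSum (d :: ds) n = min n d + truncatedSum ds (n - 1) := by
  refine (Fin.sum_univ_succ (n := ds.length) _).trans (congrArg₂ _ rfl ?_)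
  refine Finset.sum_congr rfl fun i _ => ?_
  rw [Fin.val_succ, Nat.sub_sub, add_comm 1]
  rfl

theorem truncatedSum_zero (v : List ℕ) : truncatedSum v 0 = 0 :=
  Finset.sum_eq_zero fun i _ => by simp

/-- The quantity minimized by `F_v(t)`, with `n = t + 1`. -/
def boundTerm (v : List ℕ) (n i : ℕ) : ℕ :=
  (n + 1).choose 2 - (n + 1 - i).choose 2 + (v.drop i).sum

theorem boundTerm_zero (v : List ℕ) (n : ℕ) : boundTerm v n 0 = v.sum := by simp [boundTerm]

/-- Removing one line lowers `n = t + 1` by one and accounts for `n` conditions, as `binom(n+1, 2) =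
n + binom(n, 2)`. -/
theorem boundTerm_cons_succ (d : ℕ) (ds : List ℕ) (n i : ℕ) :
    boundTerm (d :: ds) n (i + 1) = n + boundTerm ds (n - 1) i := by
  simp only [boundTerm, List.drop_succ_cons, ← add_assoc]
  congr 1
  cases n with
  | zero => simp
  | succ n =>
    have h1 : (n + 1 + 1).choose 2 = (n + 1) + (n + 1).choose 2 := by
      rw [Nat.choose_succ_succ' (n + 1) 1, Nat.choose_one_right]
    have h2 : (n + 1 - i).choose 2 ≤ (n + 1).choose 2 :=
      Nat.choose_le_choose 2 (Nat.sub_le _ _)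
    rw [show n + 1 + 1 - (i + 1) = n + 1 - i by omega, Nat.add_sub_cancel, h1]
    omega

theorem ReducesToEmpty.sum_eq {A : FatPoints K} {Ls : List (PlaneLine K)} {ds : List ℕ}
    (h : ReducesToEmpty A Ls ds) : A.degree = ds.sum := by
  induction h with
  | nil => rfl
  | @cons A L Ls ds _ ih => rw [A.degree_residual_add L, ih, List.sum_cons, add_comm]

theorem ReducesToEmpty.truncatedSum_le_hilbertFun [Infinite K] {A : FatPoints K}
    {Ls : List (PlaneLine K)} {ds : List ℕ} (h : ReducesToEmpty A Ls ds) (t : ℕ) :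
    truncatedSum ds (t + 1) ≤ hilbertFun A.ideal t := by
  induction h generalizing t with
  | nil => exact Nat.zero_le _
  | @cons A L Ls ds _ ih =>
    have hmin := min_le_hilbertFun_intersectionIdeal A L t
    rw [truncatedSum_cons, Nat.add_sub_cancel]
    cases t with
    | zero =>
      rw [truncatedSum_zero, add_zero]
      exact hmin.trans (hilbertFun_anti le_sup_left _)
    | succ t =>
      rw [hilbertFun_ideal_succ A L, add_comm]
      exact add_le_add (ih t) hmin

/-- Each of the first `i` lines imposes at most as many conditions as there are forms on a line;
what remains imposes at most its degree. -/
theorem ReducesToEmpty.hilbertFun_le_boundTerm {A : FatPoints K}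
    {Ls : List (PlaneLine K)} {ds : List ℕ} (h : ReducesToEmpty A Ls ds) {i : ℕ}
    (hi : i ≤ ds.length) (t : ℕ) : hilbertFun A.ideal t ≤ boundTerm ds (t + 1) i := by
  induction h generalizing i t with
  | nil =>
    rw [FatPoints.ideal_zero, hilbertFun_top]
    exact Nat.zero_le _
  | @cons A L Ls ds hred ih =>
    cases i with
    | zero =>
      rw [boundTerm_zero, ← (ReducesToEmpty.cons hred).sum_eq]
      exact hilbertFun_ideal_le_degree A t
    | succ i =>
      rw [boundTerm_cons_succ]
      cases t with
      | zero => exact (hilbertFun_zero_le_one _).trans (Nat.le_add_right _ _)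
      | succ t =>
        rw [hilbertFun_ideal_succ A L, add_comm]
        exact add_le_add ((hilbertFun_anti le_sup_right _).trans (hilbertFun_span_lineForm_le L _))
          (ih (Nat.le_of_succ_le_succ hi) t)

end ReductionVectors

/-! ### GMS vectors and diagonal counts -/

section GMS

theorem isGMS_iff (v : List ℕ) : IsGMS v ↔ v.Pairwise (· ≥ ·) ∧
    ∀ i j (hij : i < j) (hj : j < v.length), v[j] + j ≤ v[i] + i + 1 := by
  refine and_congr_right fun _ => ⟨fun h i j hij hj => ?_, fun h i j hij => ?_⟩
  · have := h ⟨i, hij.trans hj⟩ ⟨j, hj⟩ hij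
    simp only [List.get_eq_getElem] at this
    omega
  · have := h i j hij j.2
    simp only [List.get_eq_getElem]
    omega

theorem IsGMS.tail {d : ℕ} {ds : List ℕ} (h : IsGMS (d :: ds)) : IsGMS ds := by
  rw [isGMS_iff] at h ⊢
  refine ⟨h.1.tail, fun i j hij hj => ?_⟩
  have := h.2 (i + 1) (j + 1) (by omega) (by simpa using hj)
  simp only [List.getElem_cons_succ] at this
  omega

theorem sum_le_truncatedSum {v : List ℕ} {n : ℕ}
    (h : ∀ j (hj : j < v.length), v[j] + j ≤ n) : v.sum ≤ truncatedSum v n := by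
  rw [truncatedSum, ← Fin.sum_univ_getElem]
  refine Finset.sum_le_sum fun i _ => le_min ?_ le_rfl
  have := h i i.2
  omega

/-- If `n ≤ d`, the first summand is truncated to `n`, which matches one full line, and the tail is
treated with `n - 1`. If `n > d`, GMS gives `v[j] + j ≤ d + 1 ≤ n` for every later `j`, so nothing
is truncated and the term `i = 0` works. -/
theorem IsGMS.exists_boundTerm_le {v : List ℕ} (hv : IsGMS v) (n : ℕ) :
    ∃ i ≤ v.length, boundTerm v n i ≤ truncatedSum v n := by
  induction v generalizing n with
  | nil => exact ⟨0, le_rfl, by rw [boundTerm_zero]; rfl⟩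
  | cons d ds ih =>
    rcases le_or_gt n d with hd | hd
    · obtain ⟨i, hi, hle⟩ := ih hv.tail (n - 1)
      refine ⟨i + 1, Nat.succ_le_succ hi, ?_⟩
      rw [boundTerm_cons_succ, truncatedSum_cons, min_eq_left hd]
      exact Nat.add_le_add_left hle n
    · refine ⟨0, Nat.zero_le _, ?_⟩
      rw [boundTerm_zero]
      refine sum_le_truncatedSum fun j hj => ?_
      cases j with
      | zero => exact hd.le
      | succ j =>
        have := ((isGMS_iff _).mp hv).2 0 (j + 1) (Nat.succ_pos j) hj
        simp only [List.getElem_cons_zero] at this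
        omega

theorem diagCount_eq_sum (v : List ℕ) (k : ℕ) :
    diagCount v k = ∑ j : Fin v.length, if (j : ℕ) ≤ k ∧ k - j < v.get j then 1 else 0 := by
  rw [← Finset.card_filter, diagCount]
  have hset : {q : ℕ × ℕ | q ∈ standardConfig v ∧ q.1 + q.2 = k} =
      (fun j : Fin v.length => (k - (j : ℕ), (j : ℕ))) ''
        (Finset.univ.filter fun j : Fin v.length => (j : ℕ) ≤ k ∧ k - j < v.get j :
          Finset (Fin v.length)) := by
    ext ⟨x, y⟩
    simp only [standardConfig, Set.mem_ofPred_eq, Set.mem_image, Finset.coe_filter,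
      Finset.mem_univ, true_and, Prod.mk.injEq]
    constructor
    · rintro ⟨⟨hy, hx⟩, rfl⟩
      refine ⟨⟨y, hy⟩, ⟨Nat.le_add_left _ _, ?_⟩, Nat.add_sub_cancel _ _, rfl⟩
      rwa [Nat.add_sub_cancel]
    · rintro ⟨j, ⟨hj, hlt⟩, rfl, rfl⟩
      exact ⟨⟨j.2, hlt⟩, Nat.sub_add_cancel hj⟩
  rw [hset, Set.ncard_image_of_injective _ fun i j h => Fin.ext (Prod.ext_iff.mp h).2,
    Set.ncard_coe_finset]

/-- Row `j` meets the diagonals `k ≤ t` in an interval of `min(t + 1 - j, v[j])` points. -/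
theorem sumSeq_diagCount (v : List ℕ) (t : ℕ) :
    sumSeq (diagCount v) t = truncatedSum v (t + 1) := by
  simp only [sumSeq, diagCount_eq_sum]
  rw [Finset.sum_comm, truncatedSum]
  refine Finset.sum_congr rfl fun j _ => ?_
  rw [← Finset.card_filter]
  have : ((Finset.range (t + 1)).filter fun k => (j : ℕ) ≤ k ∧ k - j < v.get j) =
      Finset.Ico (j : ℕ) (min (t + 1) (j + v.get j)) := by
    ext k
    simp only [Finset.mem_filter, Finset.mem_range, Finset.mem_Ico]
    omega
  rw [this, Nat.card_Ico]
  omega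

end GMS

/-! ### Line count configurations and greedy removal of lines -/

section LineCount

variable {K : Type*} [Field K] {s : ℕ}

theorem circVec_perm (a m : Fin s → ℕ) {i : Fin s} (hi : 0 < a i) :
    (circVec a m).Perm (a i * m i :: circVec (Function.update a i (a i - 1)) m) := by
  have hperm := List.perm_cons_erase (List.mem_finRange i)
  have hhead : (List.range (a i)).map (fun k => (a i - k) * m i) =
      a i * m i :: (List.range (a i - 1)).map (fun k => (a i - 1 - k) * m i) := by
    obtain ⟨n, hn⟩ : ∃ n, a i = n + 1 := ⟨a i - 1, by omega⟩
    rw [hn, List.range_succ_eq_map, List.map_cons, List.map_map]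
    simp [Function.comp_def]
  refine (hperm.flatMap_right _).trans (List.Perm.trans ?_
    ((hperm.flatMap_right _).symm.cons _))
  rw [List.flatMap_cons, List.flatMap_cons, hhead, Function.update_self, List.cons_append]
  refine List.Perm.of_eq (congrArg _ (congrArg _ (List.flatMap_congr fun j hj => ?_)))
  have hne : j ≠ i := ((List.nodup_finRange s).mem_erase_iff.mp hj).1
  rw [Function.update_of_ne hne]

theorem mem_circVec {a m : Fin s → ℕ} {b : ℕ} :
    b ∈ circVec a m ↔ ∃ i, ∃ k < a i, (a i - k) * m i = b := by
  simp [circVec]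

/-- Lowering `a_i` deletes the top entry of the `i`-th block. As that entry is maximal overall, it
heads the sorted list, and a sorted permutation is unique. -/
theorem starVec_eq_cons (a m : Fin s → ℕ) {i : Fin s} (hi : 0 < a i)
    (hmax : ∀ j, a j * m j ≤ a i * m i) :
    starVec a m = a i * m i :: starVec (Function.update a i (a i - 1)) m := by
  refine List.Perm.eq_of_pairwise' (r := (· ≥ ·)) (List.pairwise_insertionSort _ _)
    (List.pairwise_cons.mpr ⟨fun b hb => ?_, List.pairwise_insertionSort _ _⟩)
    ((List.perm_insertionSort _ _).trans ((circVec_perm a m hi).trans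
      ((List.perm_insertionSort _ _).symm.cons _)))
  obtain ⟨j, k, hk, rfl⟩ := mem_circVec.mp ((List.mem_insertionSort _).mp hb)
  refine le_trans (Nat.mul_le_mul_right _ ?_) (hmax j)
  by_cases hj : j = i
  · subst hj
    rw [Function.update_self]
    omega
  · rw [Function.update_of_ne hj]
    omega

open Classical in
theorem weightedScheme_apply (a : Fin s → ℕ) (Z : Fin s → Finset (PlanePoint K))
    (p : PlanePoint K) : weightedScheme a Z p = ∑ i, if p ∈ Z i then a i else 0 := by
  simp [weightedScheme, reducedScheme, Finsupp.finsetSum_apply, Finsupp.single_apply]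

namespace IsLineCountConfiguration

variable {a m : Fin s → ℕ} {L : Fin s → PlaneLine K} {Z : Fin s → Finset (PlanePoint K)}

theorem eq_of_onLine (hZ : IsLineCountConfiguration m L Z) {i j : Fin s} {p : PlanePoint K}
    (hp : p ∈ Z j) (hL : OnLine p (L i)) : j = i := by
  by_contra hne
  exact hZ.avoids_intersections j p hp j i hne ⟨hZ.on_line j p hp, hL⟩

open Classical in
theorem weightedScheme_apply_of_onLine (hZ : IsLineCountConfiguration m L Z) {i : Fin s}
    {p : PlanePoint K} (hL : OnLine p (L i)) :
    weightedScheme a Z p = if p ∈ Z i then a i else 0 := by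
  rw [weightedScheme_apply]
  exact Finset.sum_eq_single i (fun j _ hj => if_neg fun hp => hj (hZ.eq_of_onLine hp hL))
    (fun h => absurd (Finset.mem_univ i) h)

/-- A configuration point on `L_i` belongs to `Z_i` and to no other `Z_j`, so only the weight `a_i`
changes. -/
theorem residual_weightedScheme (hZ : IsLineCountConfiguration m L Z) (i : Fin s) :
    (weightedScheme a Z).residual (L i) = weightedScheme (Function.update a i (a i - 1)) Z := by
  classical
  ext p
  rw [FatPoints.residual_apply]
  split_ifs with hL
  · rw [hZ.weightedScheme_apply_of_onLine hL, hZ.weightedScheme_apply_of_onLine hL,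
      Function.update_self]
    split_ifs <;> rfl
  · rw [weightedScheme_apply, weightedScheme_apply]
    refine Finset.sum_congr rfl fun j _ => ?_
    by_cases hp : p ∈ Z j
    · have hj : j ≠ i := by
        rintro rfl
        exact hL (hZ.on_line _ p hp)
      rw [Function.update_of_ne hj]
    · rw [if_neg hp, if_neg hp]

theorem lineDegree_weightedScheme (hZ : IsLineCountConfiguration m L Z) {i : Fin s}
    (hi : 0 < a i) : (weightedScheme a Z).lineDegree (L i) = a i * m i := by
  classical
  have hfilter : ((weightedScheme a Z).support.filter fun p => OnLine p (L i)) = Z i := by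
    ext p
    rw [Finset.mem_filter, Finsupp.mem_support_iff]
    constructor
    · rintro ⟨h0, hL⟩
      rw [hZ.weightedScheme_apply_of_onLine hL] at h0
      by_contra hp
      exact h0 (if_neg hp)
    · intro hp
      refine ⟨?_, hZ.on_line i p hp⟩
      rw [hZ.weightedScheme_apply_of_onLine (hZ.on_line i p hp), if_pos hp]
      exact hi.ne'
  rw [FatPoints.lineDegree, hfilter, Finset.sum_const_nat fun p hp => ?_, hZ.card_eq, mul_comm]
  rw [hZ.weightedScheme_apply_of_onLine (hZ.on_line i p hp), if_pos hp]

theorem exists_reducesToEmpty (hZ : IsLineCountConfiguration m L Z) (a : Fin s → ℕ) :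
    ∃ Ls, ReducesToEmpty (weightedScheme a Z) Ls (starVec a m) := by
  -- The weights vary in the induction and may reach zero, so `a` is arbitrary here.
  induction hn : ∑ i, a i using Nat.strong_induction_on generalizing a with
  | _ n ih =>
    by_cases h0 : ∀ i, a i = 0
    · refine ⟨[], ?_⟩
      have h1 : weightedScheme a Z = 0 := by simp [weightedScheme, h0]
      have h2 : circVec a m = [] := List.eq_nil_iff_forall_not_mem.mpr fun b hb => by
        obtain ⟨i, k, hk, -⟩ := mem_circVec.mp hb
        simp [h0] at hk
      rw [h1, starVec, h2]
      exact .nil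
    · push Not at h0
      obtain ⟨i₀, hi₀⟩ := h0
      -- The maximum is taken over positive weights, so that the chosen line can still lower its
      -- weight even if all products vanish.
      obtain ⟨i, hi, hmax⟩ := (Finset.univ.filter fun i => 0 < a i).exists_max_image
        (fun i => a i * m i) ⟨i₀, by simpa using Nat.pos_of_ne_zero hi₀⟩
      have hpos : 0 < a i := (Finset.mem_filter.mp hi).2
      have hmax' : ∀ j, a j * m j ≤ a i * m i := by
        intro j
        rcases Nat.eq_zero_or_pos (a j) with hj | hj
        · rw [hj, zero_mul]
          exact Nat.zero_le _
        · exact hmax j (by simpa using hj)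
      have hlt : ∑ j, Function.update a i (a i - 1) j < n := by
        rw [← hn]
        refine Finset.sum_lt_sum (fun j _ => ?_) ⟨i, Finset.mem_univ i, ?_⟩
        · by_cases hj : j = i
          · subst hj
            rw [Function.update_self]
            omega
          · rw [Function.update_of_ne hj]
        · rw [Function.update_self]
          omega
      obtain ⟨Ls, hLs⟩ := ih _ hlt _ rfl
      refine ⟨L i :: Ls, ?_⟩
      rw [starVec_eq_cons a m hpos hmax', ← hZ.lineDegree_weightedScheme hpos]
      rw [← hZ.residual_weightedScheme i] at hLs
      exact .cons hLs

end IsLineCountConfiguration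

end LineCount

theorem mainTheorem8 {K : Type*} [Field K] [IsAlgClosed K] {s : ℕ} (a m : Fin s → ℕ)
    (ha : ∀ i, 0 < a i) (hm : ∀ i, 0 < m i)
    (L : Fin s → PlaneLine K) (Z : Fin s → Finset (PlanePoint K))
    (hZ : IsLineCountConfiguration m L Z) :
    IsFullReductionVector (weightedScheme a Z) (starVec a m) ∧
    (∀ t : ℕ,
      lowerBoundFun (starVec a m) t ≤ hilbertFun (weightedScheme a Z).ideal t ∧
      hilbertFun (weightedScheme a Z).ideal t ≤ upperBoundFun (starVec a m) t) ∧
    (IsGMS (starVec a m) →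
      hilbertFun (weightedScheme a Z).ideal = lowerBoundFun (starVec a m) ∧
      lowerBoundFun (starVec a m) = upperBoundFun (starVec a m) ∧
      upperBoundFun (starVec a m) = sumSeq (diagCount (starVec a m))) := by
  have : Infinite K := IsAlgClosed.instInfinite
  obtain ⟨Ls, hLs⟩ := hZ.exists_reducesToEmpty a
  have hlower : ∀ t, lowerBoundFun (starVec a m) t ≤ hilbertFun (weightedScheme a Z).ideal t :=
    hLs.truncatedSum_le_hilbertFun
  have hupper : ∀ t, hilbertFun (weightedScheme a Z).ideal t ≤ upperBoundFun (starVec a m) t :=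
    fun t => Finset.le_inf' _ _ fun i hi =>
      hLs.hilbertFun_le_boundTerm (Nat.lt_succ_iff.mp (Finset.mem_range.mp hi)) t
  refine ⟨⟨Ls, hLs.totallyReducesWith⟩, fun t => ⟨hlower t, hupper t⟩, fun hv => ?_⟩
  have hle : ∀ t, upperBoundFun (starVec a m) t ≤ lowerBoundFun (starVec a m) t := by
    intro t
    obtain ⟨i, hi, h⟩ := hv.exists_boundTerm_le (t + 1)
    exact (Finset.inf'_le _ (Finset.mem_range.mpr (Nat.lt_succ_iff.mpr hi))).trans h
  have heq : upperBoundFun (starVec a m) = lowerBoundFun (starVec a m) :=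
    funext fun t => le_antisymm (hle t) ((hlower t).trans (hupper t))
  exact ⟨funext fun t => le_antisymm ((hupper t).trans (hle t)) (hlower t), heq.symm,
    heq.trans (funext fun t => (sumSeq_diagCount _ t).symm)⟩
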